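/- Let $\mathcal Y\subset\mathbb R^q$, let $k:\mathcal Y\times\mathcal Y\to\mathbb R$ be a measurable symmetric positive (semi)definite kernel with $\sup_y|k(y,y)|\le 1$, let $\mathcal H$ be its reproducing kernel Hilbert space and $\Phi(y)=k(y,\cdot)\in\mathcal H$. For probability measures $P,Q$ on $\mathcal Y$ let $\mathcal D(P,Q)\ge 0$ be the maximum mean discrepancy, $$\mathcal D^2(P,Q)=\mathbb E_{X,X'\sim P}k(X,X')-2\,\mathbb E_{X\sim P,\,Y'\sim Q}k(X,Y')+\mathbb E_{Y,Y'\sim Q}k(Y,Y'),$$ with independent variables in each expectation. Let $(y_t)$ be a strictly stationary $\mathcal Y$-valued process with marginal law $P_0$, set $$\varrho_t=\big|\mathbb E\langle \Phi(y_t)-\mathbb E\Phi(y_t),\,\Phi(y_0)-\mathbb E\Phi(y_0)\rangle_{\mathcal H}\big|,\qquad \Sigma_T=\sum_{t=1}^T\varrho_t$$ (expectations of $\Phi$ in the weak sense; by stationarity $\varrho_t$ depends only on the lag $t$), and let $P_T$ be the empirical measure of the first $T$ observations. Let $\Theta\subset\mathbb R^d$, let $(\mathbb U,P_{\mathbb U})$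 be a probability space of innovation paths, let $\psi(\theta,\cdot):\mathbb U\to\mathcal Y$ be measurable for every $\theta\in\Theta$, and let $P_\theta$ be the law of $\psi(\theta,\underline u)$ for $\underline u\sim P_{\mathbb U}$. Let $\underline u^{(1)},\underline u^{(2)},\dots$ be random elements of $\mathbb U$, each with law $P_{\mathbb U}$ and with arbitrary dependence between them, defined on the same probability space as $(y_t)$. Put $\tilde y_i=\tilde y_i(\theta)=\psi(\theta,\underline u^{(i)})\sim P_\theta$ and let $\hat P_\theta$ be the empirical measure of $\tilde y_1,\dots,\tilde y_N$. For $N,T\ge1$ let $\tilde\theta_{N,T}$ be (almost surely) a minimizer over $\Theta$ of $\theta\mapsto\mathcal D(\hat P_\theta,P_T)$. Assume that $\Sigma_T=o(T)$ as $T\to\infty$ and that: (i) $\theta\mapsto\mathcal D(P_\theta,P_0)$ has a unique minimizer $\theta^*$ on $\Theta$; (ii) for every $r>0$, $\inf_{\{\theta\in\Theta:\ \|\theta-\theta^*\|\ge r\}}\mathcal D(P_\theta,P_0)>\mathcal D(P_{\theta^*},P_0)$, with $\inf\emptyset=+\infty$; (iii) there is a real number $\pi>0$ such that the covering numbers satisfy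 $\mathcal N(\alpha,\Theta,\|\cdot\|)=\mathcal O(\alpha^{-\pi})$ as $\alpha\to0^+$; (iv) there are $\gamma>0$ and a measurable $m:\mathbb U\to\mathbb R$, integrable with respect to $P_{\mathbb U}$, such that for all $\underline u\in\mathbb U$ and all $\theta,\theta'\in\Theta$, $$\|\Phi(\psi(\theta,\underline u))-\Phi(\psi(\theta',\underline u))\|_{\mathcal H}\le m(\underline u)\,\|\theta-\theta'\|^{\gamma};$$ (v) the $\beta$-mixing coefficients $\beta(n;\theta)$ of the simulated sequences $(\tilde y_i(\theta))_{i\ge1}$ satisfy $\sup_{\theta\in\Theta}\beta(n;\theta)=o(n^{-(2\pi+1)})$ as $n\to\infty$, with $\pi$ as in (iii). Here $\beta(n;\theta)=\sup_{j\ge1}\beta\big(\sigma(\tilde y_i:i\le j),\sigma(\tilde y_i:i\ge j+n)\big)$, and, for sub-$\sigma$-algebras $\mathcal A,\mathcal B$, $\beta(\mathcal A,\mathcal B)=\sup_{C\in\mathcal A\otimes\mathcal B}\big|\mathbb P\{\omega:(\omega,\omega)\in C\}-(\mathbb P\otimes\mathbb P)(C)\big|$. Then $\tilde\theta_{N,T}\to\theta^*$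 in probability as $N,T\to\infty$. -/

import Mathlib

open MeasureTheory Filter Topology Asymptotics
open scoped NNReal ENNReal

noncomputable section

namespace SimMMD

/-! ### Reproducing kernels -/

section Kernel

variable {X : Type*}

/-- `H`, a Hilbert space of real functions on `X`, is the reproducing kernel Hilbert space of the
kernel `k`. Such a `k` is automatically symmetric and positive (semi)definite; conversely every
symmetric positive (semi)definite kernel has such an `H`. -/
def HasKernel (H : Type*) [NormedAddCommGroup H] [InnerProductSpace ℝ H] [CompleteSpace H]
    [RKHS ℝ H X ℝ] (k : X → X → ℝ) : Prop :=
  ∀ x y, RKHS.kernel H x y 1 = k x y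

/-- The canonical feature map `Φ(y) = k(·, y)`. -/
def featureMap (H : Type*) [NormedAddCommGroup H] [InnerProductSpace ℝ H] [CompleteSpace H]
    [RKHS ℝ H X ℝ] (y : X) : H :=
  RKHS.kerFun H y (1 : ℝ)

/-- The expectation `E[Φ(Y)] = E[k(Y, ·)] ∈ H` for `Y ∼ P`, in the weak sense: the element `g` of
`H` with `⟨g, f⟩ = E[f(Y)]` for all `f ∈ H`. It exists (and is unique) whenever `k` is measurable
with `k(y, y) ≤ 1`, see `inner_kernelMean`; no separability of `H` is needed. -/
def kernelMean (H : Type*) [NormedAddCommGroup H] [InnerProductSpace ℝ H] [CompleteSpace H]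
    [RKHS ℝ H X ℝ] [MeasurableSpace X] (P : Measure X) : H :=
  Classical.epsilon fun g : H => ∀ f : H, inner ℝ g f = ∫ x, f x ∂P

variable {H : Type*} [NormedAddCommGroup H] [InnerProductSpace ℝ H] [CompleteSpace H]
  [RKHS ℝ H X ℝ]

theorem inner_featureMap (f : H) (y : X) : inner ℝ (featureMap H y) f = f y := by
  simp [featureMap, RKHS.kerFun_inner]

theorem featureMap_apply {k : X → X → ℝ} (hk : HasKernel H k) (x y : X) :
    featureMap H y x = k x y := by
  rw [featureMap, RKHS.kerFun_apply]; exact hk x y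

theorem norm_featureMap_le {k : X → X → ℝ} (hk : HasKernel H k) (hb : ∀ y, |k y y| ≤ 1) (y : X) :
    ‖featureMap H y‖ ≤ 1 := by
  have h : ‖featureMap H y‖ ^ 2 = k y y := by
    rw [← real_inner_self_eq_norm_sq, inner_featureMap, featureMap_apply hk]
  have := (abs_le.1 (hb y)).2
  nlinarith [norm_nonneg (featureMap H y)]

theorem abs_apply_le {k : X → X → ℝ} (hk : HasKernel H k) (hb : ∀ y, |k y y| ≤ 1) (f : H) (x : X) :
    |f x| ≤ ‖f‖ := by
  rw [← inner_featureMap]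
  refine (abs_real_inner_le_norm _ _).trans ?_
  have := norm_featureMap_le (H := H) hk hb x
  nlinarith [norm_nonneg f]

variable [MeasurableSpace X]

theorem measurable_apply {k : X → X → ℝ} (hk : HasKernel H k)
    (hm : Measurable (Function.uncurry k)) (f : H) : Measurable (f : X → ℝ) := by
  have hf : f ∈ closure
      ((Submodule.span ℝ {RKHS.kerFun H x v | (x : X) (v : ℝ)} : Submodule ℝ H) : Set H) := by
    rw [← Submodule.topologicalClosure_coe, RKHS.kerFun_dense]; trivial
  obtain ⟨u, hu, hlim⟩ := mem_closure_iff_seq_limit.1 hf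
  refine measurable_of_tendsto_metrizable (f := fun n => (u n : X → ℝ)) (fun n => ?_) ?_
  · refine Submodule.span_induction (p := fun (g : H) _ => Measurable (g : X → ℝ)) ?_ ?_ ?_ ?_ (hu n)
    · rintro _ ⟨x, v, rfl⟩
      have : (RKHS.kerFun H x v : X → ℝ) = fun z => v * k z x := by
        funext z
        have h1 : v = v • (1 : ℝ) := by simp
        rw [RKHS.kerFun_apply, h1, map_smul, hk z x]; simp
      rw [this]
      exact (hm.comp (measurable_id.prodMk measurable_const)).const_mul v
    · rw [RKHS.coe_zero]; exact measurable_const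
    · intro a b _ _ ha hb; rw [RKHS.coe_add]; exact ha.add hb
    · intro c a _ ha; rw [RKHS.coe_smul]; exact ha.const_smul c
  · exact ((RKHS.coeCLM (H := H) ℝ).continuous.tendsto f).comp hlim

theorem integrable_apply {k : X → X → ℝ} (hk : HasKernel H k)
    (hm : Measurable (Function.uncurry k)) (hb : ∀ y, |k y y| ≤ 1)
    (P : Measure X) [IsProbabilityMeasure P] (f : H) : Integrable (f : X → ℝ) P :=
  Integrable.of_bound (measurable_apply hk hm f).aestronglyMeasurable ‖f‖
    (Eventually.of_forall fun x => abs_apply_le hk hb f x)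

/-- The weak expectation of the feature map exists, so `kernelMean` has its defining property. -/
theorem inner_kernelMean {k : X → X → ℝ} (hk : HasKernel H k)
    (hm : Measurable (Function.uncurry k)) (hb : ∀ y, |k y y| ≤ 1)
    (P : Measure X) [IsProbabilityMeasure P] (f : H) :
    inner ℝ (kernelMean H P) f = ∫ x, f x ∂P := by
  have hex : ∃ g : H, ∀ f : H, inner ℝ g f = ∫ x, f x ∂P := by
    let L : H →ₗ[ℝ] ℝ :=
      { toFun := fun f => ∫ x, f x ∂P
        map_add' := fun f g => by
          rw [RKHS.coe_add]
          exact integral_add (integrable_apply hk hm hb P f) (integrable_apply hk hm hb P g)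
        map_smul' := fun c f => by
          rw [RKHS.coe_smul]; exact integral_smul c _ }
    let Lc : H →L[ℝ] ℝ := L.mkContinuous 1 fun f => by
      have h := norm_integral_le_of_norm_le_const (μ := P) (f := (f : X → ℝ)) (C := ‖f‖)
        (Eventually.of_forall fun x => abs_apply_le hk hb f x)
      simpa [L] using h
    refine ⟨(InnerProductSpace.toDual ℝ H).symm Lc, fun f => ?_⟩
    rw [InnerProductSpace.toDual_symm_apply]; rfl
  exact Classical.epsilon_spec hex f

/-! ### Maximum mean discrepancy and empirical measures -/

/-- The squared MMD:
`E k(X, X') - 2 E k(X, Y') + E k(Y, Y')` with `X, X' ∼ P` and `Y, Y' ∼ Q` independent. -/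
def mmdSq (k : X → X → ℝ) (P Q : Measure X) : ℝ :=
  (∫ z, k z.1 z.2 ∂(P.prod P)) - 2 * (∫ z, k z.1 z.2 ∂(P.prod Q)) + ∫ z, k z.1 z.2 ∂(Q.prod Q)

/-- The maximum mean discrepancy `𝒟(P, Q)`. -/
def mmd (k : X → X → ℝ) (P Q : Measure X) : ℝ :=
  √(mmdSq k P Q)

/-- The empirical measure `n⁻¹ ∑_{i < n} δ_{z i}` of the first `n` terms of a sequence. -/
def empirical (n : ℕ) (z : ℕ → X) : Measure X :=
  (n : ℝ≥0∞)⁻¹ • ∑ i ∈ Finset.range n, Measure.dirac (z i)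

end Kernel

/-! ### Dependence of stochastic processes -/

section Dependence

variable {Ω X : Type*}

/-- Strict stationarity of a process `(Z_t)_{t ∈ ℕ}`: all its shifts have the same law. -/
def StrictlyStationary [MeasurableSpace Ω] [MeasurableSpace X] (μ : Measure Ω) (Z : ℕ → Ω → X) : Prop :=
  ∀ h : ℕ, ProbabilityTheory.IdentDistrib (fun ω t => Z (t + h) ω) (fun ω t => Z t ω) μ μ

/-- The serial dependence coefficient
`ϱ_t = |E ⟨k(Z_t, ·) - E[k(Z_t, ·)], k(Z_0, ·) - E[k(Z_0, ·)]⟩|`. -/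
def rho (H : Type*) [NormedAddCommGroup H] [InnerProductSpace ℝ H] [CompleteSpace H]
    [RKHS ℝ H X ℝ] [MeasurableSpace Ω] [MeasurableSpace X] (μ : Measure Ω) (Z : ℕ → Ω → X) (t : ℕ) : ℝ :=
  |∫ ω, inner ℝ (featureMap H (Z t ω) - kernelMean H (μ.map (Z t)))
    (featureMap H (Z 0 ω) - kernelMean H (μ.map (Z 0))) ∂μ|

/-- `ϱ_t` as a difference of expectations of the kernel. -/
theorem rho_eq {H : Type*} [NormedAddCommGroup H] [InnerProductSpace ℝ H] [CompleteSpace H]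
    [RKHS ℝ H X ℝ] [MeasurableSpace Ω] [MeasurableSpace X] {k : X → X → ℝ} (hk : HasKernel H k)
    (hm : Measurable (Function.uncurry k)) (hb : ∀ y, |k y y| ≤ 1)
    (μ : Measure Ω) [IsProbabilityMeasure μ] (Z : ℕ → Ω → X) (hZ : ∀ t, Measurable (Z t)) (t : ℕ) :
    rho H μ Z t =
      |(∫ ω, k (Z t ω) (Z 0 ω) ∂μ) - ∫ x, ∫ y, k x y ∂(μ.map (Z 0)) ∂(μ.map (Z t))| := by
  have hPt : IsProbabilityMeasure (μ.map (Z t)) :=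
    Measure.isProbabilityMeasure_map (hZ t).aemeasurable
  have hP0 : IsProbabilityMeasure (μ.map (Z 0)) :=
    Measure.isProbabilityMeasure_map (hZ 0).aemeasurable
  set g := kernelMean H (μ.map (Z t)) with hg
  set h := kernelMean H (μ.map (Z 0)) with hh
  have hmean : ∀ x, h x = ∫ y, k x y ∂(μ.map (Z 0)) := fun x => by
    rw [← inner_featureMap, real_inner_comm, hh, inner_kernelMean hk hm hb]
    refine integral_congr_ae (Eventually.of_forall fun y => ?_)
    rw [← inner_featureMap, real_inner_comm, inner_featureMap, featureMap_apply hk]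
  have hgh : inner ℝ g h = ∫ x, ∫ y, k x y ∂(μ.map (Z 0)) ∂(μ.map (Z t)) := by
    rw [hg, inner_kernelMean hk hm hb]
    exact integral_congr_ae (Eventually.of_forall hmean)
  have hint : ∀ (f : H) (s : ℕ), Integrable (fun ω => f (Z s ω)) μ := fun f s =>
    Integrable.of_bound ((measurable_apply hk hm f).comp (hZ s)).aestronglyMeasurable ‖f‖
      (Eventually.of_forall fun ω => abs_apply_le hk hb f _)
  have hintk : Integrable (fun ω => k (Z t ω) (Z 0 ω)) μ := by
    refine Integrable.of_bound (hm.comp ((hZ t).prodMk (hZ 0))).aestronglyMeasurable 1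
      (Eventually.of_forall fun ω => ?_)
    rw [← featureMap_apply hk]
    exact (abs_apply_le hk hb _ _).trans (norm_featureMap_le hk hb _)
  have e1 : ∫ ω, h (Z t ω) ∂μ = inner ℝ g h := by
    rw [hg, inner_kernelMean hk hm hb,
      integral_map (hZ t).aemeasurable (measurable_apply hk hm h).aestronglyMeasurable]
  have e2 : ∫ ω, g (Z 0 ω) ∂μ = inner ℝ g h := by
    rw [real_inner_comm, hh, inner_kernelMean hk hm hb,
      integral_map (hZ 0).aemeasurable (measurable_apply hk hm g).aestronglyMeasurable]
  have e3 : ∀ ω, inner ℝ (featureMap H (Z t ω) - g) (featureMap H (Z 0 ω) - h) =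
      k (Z t ω) (Z 0 ω) - h (Z t ω) - (g (Z 0 ω) - inner ℝ g h) := fun ω => by
    rw [inner_sub_left, inner_sub_right, inner_sub_right, inner_featureMap, inner_featureMap,
      real_inner_comm _ g, inner_featureMap, featureMap_apply hk]
  rw [rho, ← hgh]
  simp_rw [← hg, ← hh, e3]
  have h1 : Integrable (fun ω => k (Z t ω) (Z 0 ω) - h (Z t ω)) μ := hintk.sub (hint h t)
  have h2 : Integrable (fun ω => g (Z 0 ω) - inner ℝ g h) μ :=
    (hint g 0).sub (integrable_const _)
  rw [integral_sub h1 h2, integral_sub hintk (hint h t),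
    integral_sub (hint g 0) (integrable_const _), e1, e2]
  simp

/-- The β-mixing coefficient of two sub-σ-algebras `𝒜, ℬ`: the supremum over `C ∈ 𝒜 ⊗ ℬ` of
`|μ^Δ(C) - (μ ⊗ μ)(C)|`, where `μ^Δ` is the image of `μ` under `ω ↦ (ω, ω)`. -/
def betaCoeff (𝒜 ℬ : MeasurableSpace Ω) [MeasurableSpace Ω] (μ : Measure Ω) : ℝ :=
  ⨆ C : {C : Set (Ω × Ω) // MeasurableSet[𝒜.prod ℬ] C},
    |μ.real {ω | (ω, ω) ∈ C.1} - (μ.prod μ).real C.1|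

/-- The β-mixing coefficients of a process `(Z_i)_{i ∈ ℕ}`:
`β(n) = sup_j β(σ(Z_i : i ≤ j), σ(Z_i : i ≥ j + n))`. -/
def betaMixing [MeasurableSpace Ω] [mX : MeasurableSpace X] (μ : Measure Ω) (Z : ℕ → Ω → X)
    (n : ℕ) : ℝ :=
  ⨆ j : ℕ, betaCoeff (⨆ i ∈ Set.Iic j, mX.comap (Z i)) (⨆ i ∈ Set.Ici (j + n), mX.comap (Z i)) μ

theorem abs_sub_le_one_aux [MeasurableSpace Ω] (μ : Measure Ω) [IsProbabilityMeasure μ]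
    (C : Set (Ω × Ω)) : |μ.real {ω | (ω, ω) ∈ C} - (μ.prod μ).real C| ≤ 1 := by
  have h1 : μ.real {ω | (ω, ω) ∈ C} ≤ 1 := measureReal_le_one
  have h2 : (μ.prod μ).real C ≤ 1 := measureReal_le_one
  have h3 : 0 ≤ μ.real {ω | (ω, ω) ∈ C} := measureReal_nonneg
  have h4 : 0 ≤ (μ.prod μ).real C := measureReal_nonneg
  rw [abs_le]; constructor <;> linarith

/-- The supremum that defines `betaCoeff` is a supremum of a bounded set. -/
theorem bddAbove_betaCoeff (𝒜 ℬ : MeasurableSpace Ω) [MeasurableSpace Ω] (μ : Measure Ω)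
    [IsProbabilityMeasure μ] :
    BddAbove (Set.range fun C : {C : Set (Ω × Ω) // MeasurableSet[𝒜.prod ℬ] C} =>
        |μ.real {ω | (ω, ω) ∈ C.1} - (μ.prod μ).real C.1|) :=
  ⟨1, by rintro _ ⟨C, rfl⟩; exact abs_sub_le_one_aux μ C.1⟩

theorem betaCoeff_le_one (𝒜 ℬ : MeasurableSpace Ω) [MeasurableSpace Ω] (μ : Measure Ω)
    [IsProbabilityMeasure μ] : betaCoeff 𝒜 ℬ μ ≤ 1 :=
  haveI : Nonempty {C : Set (Ω × Ω) // MeasurableSet[𝒜.prod ℬ] C} :=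
    ⟨⟨∅, @MeasurableSet.empty _ (𝒜.prod ℬ)⟩⟩
  ciSup_le fun C => abs_sub_le_one_aux μ C.1

/-- The supremum that defines `betaMixing` is a supremum of a bounded set. -/
theorem bddAbove_betaMixing [MeasurableSpace Ω] [mX : MeasurableSpace X] (μ : Measure Ω)
    [IsProbabilityMeasure μ] (Z : ℕ → Ω → X) (n : ℕ) :
    BddAbove (Set.range fun j : ℕ => betaCoeff (⨆ i ∈ Set.Iic j, mX.comap (Z i))
      (⨆ i ∈ Set.Ici (j + n), mX.comap (Z i)) μ) :=
  ⟨1, by rintro _ ⟨j, rfl⟩; exact betaCoeff_le_one _ _ μ⟩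

theorem betaMixing_le_one [MeasurableSpace Ω] [MeasurableSpace X] (μ : Measure Ω)
    [IsProbabilityMeasure μ] (Z : ℕ → Ω → X) (n : ℕ) : betaMixing μ Z n ≤ 1 :=
  ciSup_le fun _ => betaCoeff_le_one _ _ μ

end Dependence

end SimMMD

end

/-!
For probability measures the MMD is the distance `‖kernelMean P - kernelMean Q‖` between kernel
means (`mmd_eq_norm_sub`), so it obeys the triangle inequality, and the kernel mean of an empirical
measure is the average of the feature vectors.

*One parameter value.* The expectation of `𝒟²(P̂, P)` for an empirical measure is the average of the
covariances `E⟨Φ(Z_i) - E Φ, Φ(Z_j) - E Φ⟩` over all pairs `(i, j)`. When these are at most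
`a |i - j|`, it is at most `2 n⁻¹ ∑_{l < n} a l`, and Markov's inequality gives convergence in
probability as soon as the Cesàro means of `a` vanish (`tendsto_measureReal_mmd_empirical`). For the
observations `a = ϱ`, by stationarity; for the simulations `a = 2 β`, by the layer-cake formula
(`abs_integral_inner_featureMap_sub_le_betaMixing`).

*Uniformity in the parameter.* Finite covering numbers make `Θ` totally bounded, and `𝒟(P̂_θ, P_θ)`
is Hölder in `θ` with the random constant `N⁻¹ ∑_{i ≤ N} |m(u_i)| + E|m|`, whose expectation does not
depend on `N`. A finite net on which the pointwise result applies, together with Markov's inequality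
for the Hölder constant, shows that `sup_θ 𝒟(P̂_θ, P_θ)` tends to `0` in probability
(`tendsto_measureReal_exists_of_holder`).

*Argmin.* If the estimator is at distance at least `r` from `θ*`, the population criterion there
exceeds its minimum by a fixed `δ > 0`. By the triangle inequality one of `sup_θ 𝒟(P̂_θ, P_θ)` and
`𝒟(P_T, P_0)` is then at least `δ / 4`, an event of vanishing probability.
-/

namespace SimMMD

/-! ### MMD as a distance of kernel means -/

section Kernel

variable {X : Type*} {H : Type*} [NormedAddCommGroup H]
  [InnerProductSpace ℝ H] [CompleteSpace H] [RKHS ℝ H X ℝ] {k : X → X → ℝ}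

theorem inner_featureMap_sub (hk : HasKernel H k) (g : H) (x y : X) :
    inner ℝ (featureMap H x - g) (featureMap H y - g) = k x y - g x - g y + inner ℝ g g := by
  rw [inner_sub_left, inner_sub_right, inner_sub_right, inner_featureMap, inner_featureMap,
    real_inner_comm _ g, inner_featureMap, featureMap_apply hk]
  ring

theorem abs_kernel_le (hk : HasKernel H k) (hb : ∀ y, |k y y| ≤ 1) (x y : X) : |k x y| ≤ 1 := by
  rw [← featureMap_apply hk]
  exact (abs_apply_le hk hb _ _).trans (norm_featureMap_le hk hb _)

theorem abs_inner_featureMap_sub_le (hk : HasKernel H k) (hb : ∀ y, |k y y| ≤ 1) (g : H)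
    (x y : X) :
    |inner ℝ (featureMap H x - g) (featureMap H y - g)| ≤ (1 + ‖g‖) * (1 + ‖g‖) := by
  have h : ∀ z : X, ‖featureMap H z - g‖ ≤ 1 + ‖g‖ := fun z =>
    (norm_sub_le _ _).trans (add_le_add_left (norm_featureMap_le hk hb z) _)
  exact (abs_real_inner_le_norm _ _).trans
    (mul_le_mul (h x) (h y) (norm_nonneg _) (by positivity))

theorem integral_inner_featureMap_sub_comm {Ω : Type*} [MeasurableSpace Ω] (μ : Measure Ω)
    (g : H) (Z W : Ω → X) :
    ∫ ω, inner ℝ (featureMap H (Z ω) - g) (featureMap H (W ω) - g) ∂μ =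
      ∫ ω, inner ℝ (featureMap H (W ω) - g) (featureMap H (Z ω) - g) ∂μ := by
  simp_rw [real_inner_comm]

variable [MeasurableSpace X]

theorem measurable_inner_featureMap_sub (hk : HasKernel H k)
    (hm : Measurable (Function.uncurry k)) (g : H) :
    Measurable fun p : X × X => inner ℝ (featureMap H p.1 - g) (featureMap H p.2 - g) := by
  simp_rw [inner_featureMap_sub hk]
  have hg := measurable_apply hk hm g
  exact ((hm.sub (hg.comp measurable_fst)).sub (hg.comp measurable_snd)).add_const _

theorem integrable_inner_featureMap_sub (hk : HasKernel H k)
    (hm : Measurable (Function.uncurry k)) (hb : ∀ y, |k y y| ≤ 1) {Ω : Type*}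
    [MeasurableSpace Ω] {μ : Measure Ω} [IsProbabilityMeasure μ] (g : H) {Z W : Ω → X}
    (hZ : Measurable Z) (hW : Measurable W) :
    Integrable (fun ω => inner ℝ (featureMap H (Z ω) - g) (featureMap H (W ω) - g)) μ :=
  Integrable.of_bound
    ((measurable_inner_featureMap_sub hk hm g).comp (hZ.prodMk hW)).aestronglyMeasurable
    ((1 + ‖g‖) * (1 + ‖g‖))
    (Eventually.of_forall fun _ => abs_inner_featureMap_sub_le hk hb g _ _)

theorem integrable_kernel (hk : HasKernel H k) (hm : Measurable (Function.uncurry k))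
    (hb : ∀ y, |k y y| ≤ 1) (R : Measure (X × X)) [IsProbabilityMeasure R] :
    Integrable (fun z => k z.1 z.2) R :=
  Integrable.of_bound hm.aestronglyMeasurable 1
    (Eventually.of_forall fun z => abs_kernel_le hk hb z.1 z.2)

/-- Expectations of the kernel under product measures are inner products of kernel means. -/
theorem integral_kernel_prod (hk : HasKernel H k) (hm : Measurable (Function.uncurry k))
    (hb : ∀ y, |k y y| ≤ 1) (P Q : Measure X) [IsProbabilityMeasure P] [IsProbabilityMeasure Q] :
    ∫ z, k z.1 z.2 ∂(P.prod Q) = inner ℝ (kernelMean H P) (kernelMean H Q) := by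
  rw [integral_prod _ (integrable_kernel hk hm hb _), inner_kernelMean hk hm hb]
  refine integral_congr_ae (Eventually.of_forall fun x => ?_)
  change ∫ y, k x y ∂Q = kernelMean H Q x
  rw [← inner_featureMap, real_inner_comm, inner_kernelMean hk hm hb]
  refine integral_congr_ae (Eventually.of_forall fun y => ?_)
  rw [← inner_featureMap, real_inner_comm, inner_featureMap, featureMap_apply hk]

theorem mmd_eq_norm_sub (hk : HasKernel H k) (hm : Measurable (Function.uncurry k))
    (hb : ∀ y, |k y y| ≤ 1) (P Q : Measure X) [IsProbabilityMeasure P] [IsProbabilityMeasure Q] :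
    mmd k P Q = ‖kernelMean H P - kernelMean H Q‖ := by
  rw [mmd, mmdSq, integral_kernel_prod hk hm hb, integral_kernel_prod hk hm hb,
    integral_kernel_prod hk hm hb, real_inner_self_eq_norm_sq, real_inner_self_eq_norm_sq,
    ← norm_sub_sq_real, Real.sqrt_sq (norm_nonneg _)]

theorem isProbabilityMeasure_empirical {n : ℕ} (hn : 1 ≤ n) (z : ℕ → X) :
    IsProbabilityMeasure (empirical n z) := by
  constructor
  have hn0 : (n : ℝ≥0∞) ≠ 0 := by exact_mod_cast (by omega : n ≠ 0)
  simp [empirical, ENNReal.inv_mul_cancel hn0 (ENNReal.natCast_ne_top n)]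

theorem kernelMean_empirical (hk : HasKernel H k) (hm : Measurable (Function.uncurry k))
    (hb : ∀ y, |k y y| ≤ 1) {n : ℕ} (hn : 1 ≤ n) (z : ℕ → X) :
    kernelMean H (empirical n z) = (n : ℝ)⁻¹ • ∑ i ∈ Finset.range n, featureMap H (z i) := by
  have := isProbabilityMeasure_empirical hn z
  refine ext_inner_right ℝ fun f => ?_
  have hf := measurable_apply hk hm f
  rw [inner_kernelMean hk hm hb, empirical, integral_smul_measure,
    integral_finsetSum_measure fun i _ => integrable_apply hk hm hb _ f,
    inner_smul_left, sum_inner]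
  simp [integral_dirac' _ _ hf.stronglyMeasurable, inner_featureMap]

/-- A pointwise bound on feature increments integrates to a bound on the distance of kernel means.
The feature map need not be Bochner measurable, so the squared distance is instead computed weakly,
by testing both kernel means against their difference. -/
theorem norm_kernelMean_map_sub_le (hk : HasKernel H k) (hm : Measurable (Function.uncurry k))
    (hb : ∀ y, |k y y| ≤ 1) {𝕌 : Type*} [MeasurableSpace 𝕌] (P : Measure 𝕌)
    [IsProbabilityMeasure P] {φ χ : 𝕌 → X} (hφ : Measurable φ) (hχ : Measurable χ) {b : 𝕌 → ℝ}
    (hbi : Integrable b P) (h : ∀ u, ‖featureMap H (φ u) - featureMap H (χ u)‖ ≤ b u) :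
    ‖kernelMean H (P.map φ) - kernelMean H (P.map χ)‖ ≤ ∫ u, b u ∂P := by
  have := Measure.isProbabilityMeasure_map (μ := P) hφ.aemeasurable
  have := Measure.isProbabilityMeasure_map (μ := P) hχ.aemeasurable
  set v := kernelMean H (P.map φ) - kernelMean H (P.map χ) with hv
  have hint : ∀ {χ : 𝕌 → X}, Measurable χ → Integrable (fun u => v (χ u)) P := fun hχ =>
    Integrable.of_bound ((measurable_apply hk hm v).comp hχ).aestronglyMeasurable ‖v‖
      (Eventually.of_forall fun u => abs_apply_le hk hb v _)
  have hsq : ‖v‖ * ‖v‖ = ∫ u, (v (φ u) - v (χ u)) ∂P := by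
    rw [integral_sub (hint hφ) (hint hχ), ← real_inner_self_eq_norm_mul_norm]
    conv_lhs => rw [hv, inner_sub_left, ← hv]
    rw [inner_kernelMean hk hm hb, inner_kernelMean hk hm hb,
      integral_map hφ.aemeasurable (measurable_apply hk hm v).aestronglyMeasurable,
      integral_map hχ.aemeasurable (measurable_apply hk hm v).aestronglyMeasurable]
  have hle : ‖v‖ * ‖v‖ ≤ (∫ u, b u ∂P) * ‖v‖ := by
    rw [hsq, ← integral_mul_const]
    refine integral_mono ((hint hφ).sub (hint hχ)) (hbi.mul_const _) fun u => ?_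
    change v (φ u) - v (χ u) ≤ b u * ‖v‖
    rw [← inner_featureMap, ← inner_featureMap, ← inner_sub_left]
    exact (real_inner_le_norm _ _).trans (mul_le_mul_of_nonneg_right (h u) (norm_nonneg _))
  rcases (norm_nonneg v).eq_or_lt with h0 | h0
  · rw [← h0]
    exact integral_nonneg fun u => (norm_nonneg _).trans (h u)
  · exact le_of_mul_le_mul_right hle h0

end Kernel

/-! ### Covariances in the reproducing kernel Hilbert space -/

section Dependence

variable {Ω X : Type*} [MeasurableSpace Ω] [MeasurableSpace X]

/-- Measures that differ by at most `b` on every set integrate a function with values in `[-1, 1]`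
to within `2 * b`, by the layer-cake formula. -/
theorem abs_integral_sub_integral_le {ν₁ ν₂ : Measure X} [IsProbabilityMeasure ν₁]
    [IsProbabilityMeasure ν₂] {f : X → ℝ} (hf : Measurable f) (hf1 : ∀ x, |f x| ≤ 1) {b : ℝ}
    (hb : ∀ B, MeasurableSet B → |ν₁.real B - ν₂.real B| ≤ b) :
    |∫ x, f x ∂ν₁ - ∫ x, f x ∂ν₂| ≤ 2 * b := by
  have hfi : ∀ ν : Measure X, [IsProbabilityMeasure ν] → Integrable f ν := fun ν _ =>
    Integrable.of_bound hf.aestronglyMeasurable 1 (Eventually.of_forall hf1)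
  have key : ∀ ν : Measure X, [IsProbabilityMeasure ν] →
      ∫ x, f x ∂ν + 1 = ∫ t in Set.Ioc (0 : ℝ) 2, ν.real {x | t ≤ f x + 1} := fun ν _ => by
    rw [← Integrable.integral_eq_integral_Ioc_meas_le (f := fun x => f x + 1)
      ((hfi ν).add (integrable_const _))
      (Eventually.of_forall fun x => by have := (abs_le.1 (hf1 x)).1; simp; linarith)
      (Eventually.of_forall fun x => by have := (abs_le.1 (hf1 x)).2; simp; linarith),
      integral_add (hfi ν) (integrable_const _)]
    simp
  have hint : ∀ ν : Measure X, [IsProbabilityMeasure ν] →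
      IntegrableOn (fun t : ℝ => ν.real {x | t ≤ f x + 1}) (Set.Ioc 0 2) := fun ν _ => by
    have hanti : Antitone fun t : ℝ => ν.real {x | t ≤ f x + 1} := fun s t hst =>
      measureReal_mono fun x (hx : t ≤ f x + 1) => hst.trans hx
    exact Integrable.of_bound hanti.measurable.aestronglyMeasurable 1
      (Eventually.of_forall fun t => by
        rw [Real.norm_of_nonneg measureReal_nonneg]; exact measureReal_le_one)
  have e : ∫ x, f x ∂ν₁ - ∫ x, f x ∂ν₂ =
      ∫ t in Set.Ioc (0 : ℝ) 2, (ν₁.real {x | t ≤ f x + 1} - ν₂.real {x | t ≤ f x + 1}) := by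
    rw [integral_sub (hint ν₁) (hint ν₂), ← key ν₁, ← key ν₂]; ring
  rw [e]
  have := norm_setIntegral_le_of_norm_le_const (μ := volume) (s := Set.Ioc (0 : ℝ) 2)
    (f := fun t => ν₁.real {x | t ≤ f x + 1} - ν₂.real {x | t ≤ f x + 1}) (C := b)
    (by simp) fun t _ => hb _ (measurableSet_le measurable_const (hf.add_const 1))
  simpa [mul_comm] using this

/-- The mixing coefficient at lag `i - j` bounds the distance between the joint law of
`(Z j, Z i)` and the product of the marginals. -/
theorem abs_map_prodMk_sub_prod_le_betaMixing (μ : Measure Ω) [IsProbabilityMeasure μ]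
    {Z : ℕ → Ω → X} (hZ : ∀ i, Measurable (Z i)) {i j : ℕ} (hji : j ≤ i) {B : Set (X × X)}
    (hB : MeasurableSet B) :
    |(μ.map fun ω => (Z j ω, Z i ω)).real B - ((μ.map (Z j)).prod (μ.map (Z i))).real B| ≤
      betaMixing μ Z (i - j) := by
  have hC : MeasurableSet[(⨆ l ∈ Set.Iic j, MeasurableSpace.comap (Z l) inferInstance).prod
      (⨆ l ∈ Set.Ici (j + (i - j)), MeasurableSpace.comap (Z l) inferInstance)]
      (Prod.map (Z j) (Z i) ⁻¹' B) := by
    have h1 : Measurable[⨆ l ∈ Set.Iic j, MeasurableSpace.comap (Z l) inferInstance] (Z j) :=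
      (comap_measurable (Z j)).mono
        (le_iSup₂_of_le (f := fun l (_ : l ∈ Set.Iic j) =>
          MeasurableSpace.comap (Z l) inferInstance) j (Set.mem_Iic.2 le_rfl) le_rfl) le_rfl
    have h2 : Measurable[⨆ l ∈ Set.Ici (j + (i - j)),
        MeasurableSpace.comap (Z l) inferInstance] (Z i) :=
      (comap_measurable (Z i)).mono
        (le_iSup₂_of_le (f := fun l (_ : l ∈ Set.Ici (j + (i - j))) =>
          MeasurableSpace.comap (Z l) inferInstance) i (Set.mem_Ici.2 (by omega)) le_rfl) le_rfl
    exact (@Measurable.prodMap _ _ _ _ _ (_) _ (_) _ _ h1 h2) hB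
  have e1 : (μ.map fun ω => (Z j ω, Z i ω)).real B =
      μ.real {ω | (ω, ω) ∈ Prod.map (Z j) (Z i) ⁻¹' B} := by
    rw [map_measureReal_apply ((hZ j).prodMk (hZ i)) hB]; rfl
  have e2 : ((μ.map (Z j)).prod (μ.map (Z i))).real B =
      (μ.prod μ).real (Prod.map (Z j) (Z i) ⁻¹' B) := by
    rw [Measure.map_prod_map _ _ (hZ j) (hZ i),
      map_measureReal_apply ((hZ j).prodMap (hZ i)) hB]
  rw [e1, e2]
  exact (le_ciSup (bddAbove_betaCoeff _ _ μ) ⟨_, hC⟩).trans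
    (le_ciSup (bddAbove_betaMixing μ Z (i - j)) j)

variable {H : Type*} [NormedAddCommGroup H] [InnerProductSpace ℝ H] [CompleteSpace H]
  [RKHS ℝ H X ℝ] {k : X → X → ℝ}

/-- Covariance inequality: in the RKHS, covariances are at most twice the mixing coefficient. -/
theorem abs_integral_inner_featureMap_sub_le_betaMixing (hk : HasKernel H k)
    (hm : Measurable (Function.uncurry k)) (hb : ∀ y, |k y y| ≤ 1) (μ : Measure Ω)
    [IsProbabilityMeasure μ] {Z : ℕ → Ω → X} (hZ : ∀ i, Measurable (Z i)) {P : Measure X}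
    [IsProbabilityMeasure P] (hP : ∀ i, μ.map (Z i) = P) {i j : ℕ} (hji : j ≤ i) :
    |∫ ω, inner ℝ (featureMap H (Z i ω) - kernelMean H P)
      (featureMap H (Z j ω) - kernelMean H P) ∂μ| ≤ 2 * betaMixing μ Z (i - j) := by
  have hmap : IsProbabilityMeasure (μ.map fun ω => (Z j ω, Z i ω)) :=
    Measure.isProbabilityMeasure_map ((hZ j).prodMk (hZ i)).aemeasurable
  set g := kernelMean H P with hg
  have hint : ∀ s, Integrable (fun ω => g (Z s ω)) μ := fun s =>
    Integrable.of_bound ((measurable_apply hk hm g).comp (hZ s)).aestronglyMeasurable ‖g‖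
      (Eventually.of_forall fun ω => abs_apply_le hk hb g _)
  have hintk : Integrable (fun ω => k (Z j ω) (Z i ω)) μ :=
    Integrable.of_bound (hm.comp ((hZ j).prodMk (hZ i))).aestronglyMeasurable 1
      (Eventually.of_forall fun ω => abs_kernel_le hk hb _ _)
  have hgZ : ∀ s, ∫ ω, g (Z s ω) ∂μ = inner ℝ g g := fun s => by
    conv_rhs => rw [hg, inner_kernelMean hk hm hb, ← hg]
    rw [← hP s, integral_map (hZ s).aemeasurable (measurable_apply hk hm g).aestronglyMeasurable]
  have hint₁ : Integrable (fun ω => k (Z j ω) (Z i ω) - g (Z j ω)) μ := hintk.sub (hint j)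
  have hint₂ : Integrable (fun ω => k (Z j ω) (Z i ω) - g (Z j ω) - g (Z i ω)) μ :=
    hint₁.sub (hint i)
  have e : ∫ ω, inner ℝ (featureMap H (Z i ω) - g) (featureMap H (Z j ω) - g) ∂μ =
      ∫ z, k z.1 z.2 ∂(μ.map fun ω => (Z j ω, Z i ω)) -
        ∫ z, k z.1 z.2 ∂((μ.map (Z j)).prod (μ.map (Z i))) := by
    rw [integral_inner_featureMap_sub_comm, hP, hP, integral_kernel_prod hk hm hb,
      integral_map (f := fun z : X × X => k z.1 z.2) ((hZ j).prodMk (hZ i)).aemeasurable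
        hm.aestronglyMeasurable]
    simp_rw [inner_featureMap_sub hk]
    rw [integral_add hint₂ (integrable_const _), integral_sub hint₁ (hint i),
      integral_sub hintk (hint j), hgZ, hgZ, ← hg]
    simp
  rw [e]
  have : IsProbabilityMeasure (μ.map (Z j)) := by rw [hP]; infer_instance
  have : IsProbabilityMeasure (μ.map (Z i)) := by rw [hP]; infer_instance
  exact abs_integral_sub_integral_le hm (fun z => abs_kernel_le hk hb z.1 z.2)
    fun B hB => abs_map_prodMk_sub_prod_le_betaMixing μ hZ hji hB

theorem StrictlyStationary.map_eq {μ : Measure Ω} {Z : ℕ → Ω → X} (h : StrictlyStationary μ Z)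
    (t : ℕ) : μ.map (Z t) = μ.map (Z 0) := by
  have := ((h t).comp (measurable_pi_apply 0)).map_eq
  simpa [Function.comp_def] using this

/-- For a stationary process the covariance in the RKHS at times `s ≥ t` is `ϱ_{s - t}`. -/
theorem StrictlyStationary.abs_integral_inner_eq_rho (hk : HasKernel H k)
    (hm : Measurable (Function.uncurry k)) {μ : Measure Ω} {Z : ℕ → Ω → X}
    (h : StrictlyStationary μ Z) {s t : ℕ} (hts : t ≤ s) :
    |∫ ω, inner ℝ (featureMap H (Z s ω) - kernelMean H (μ.map (Z 0)))
      (featureMap H (Z t ω) - kernelMean H (μ.map (Z 0))) ∂μ| = rho H μ Z (s - t) := by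
  have hF := measurable_inner_featureMap_sub hk hm (kernelMean H (μ.map (Z 0)))
  have hpair : Measurable fun z : ℕ → X => (z (s - t), z 0) :=
    (measurable_pi_apply _).prodMk (measurable_pi_apply _)
  have := ((h t).comp (hF.comp hpair)).integral_eq
  simp only [Function.comp_def, Nat.sub_add_cancel hts, Nat.zero_add] at this
  rw [rho, h.map_eq (s - t), this]

/-! ### Empirical measures of dependent sequences -/

theorem sum_sum_le_of_le_lag {c : ℕ → ℕ → ℝ} {a : ℕ → ℝ} (hsymm : ∀ i j, c i j = c j i)
    (ha : ∀ i, 0 ≤ a i) (hc : ∀ i j, j ≤ i → c i j ≤ a (i - j)) (n : ℕ) :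
    ∑ i ∈ Finset.range n, ∑ j ∈ Finset.range n, c i j ≤ n * (2 * ∑ l ∈ Finset.range n, a l) := by
  induction n with
  | zero => simp
  | succ n ih =>
    have hrow : ∑ j ∈ Finset.range (n + 1), c n j ≤ ∑ l ∈ Finset.range (n + 1), a l := by
      rw [← Finset.sum_range_reflect a]
      refine Finset.sum_le_sum fun j hj => ?_
      have := hc n j (by simpa [Nat.lt_succ_iff] using hj)
      simpa using this
    have hrow' : ∑ j ∈ Finset.range n, c n j ≤ ∑ l ∈ Finset.range (n + 1), a l := by
      have h2 : ∑ j ∈ Finset.range n, c n j ≤ ∑ j ∈ Finset.range n, a (n - j) :=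
        Finset.sum_le_sum fun j hj => hc n j (Finset.mem_range.1 hj).le
      have h3 : ∑ l ∈ Finset.range (n + 1), a l = ∑ j ∈ Finset.range (n + 1), a (n - j) := by
        rw [← Finset.sum_range_reflect a]; simp
      rw [h3, Finset.sum_range_succ]
      linarith [ha (n - n)]
    have hA : ∑ l ∈ Finset.range n, a l ≤ ∑ l ∈ Finset.range (n + 1), a l := by
      rw [Finset.sum_range_succ]; linarith [ha n]
    have hsplit : ∑ i ∈ Finset.range (n + 1), ∑ j ∈ Finset.range (n + 1), c i j =
        ∑ i ∈ Finset.range n, ∑ j ∈ Finset.range n, c i j + ∑ j ∈ Finset.range n, c n j +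
          ∑ j ∈ Finset.range (n + 1), c n j := by
      rw [Finset.sum_range_succ]
      congr 1
      simp_rw [Finset.sum_range_succ]
      rw [Finset.sum_add_distrib]
      congr 1
      exact Finset.sum_congr rfl fun i _ => hsymm i n
    have hmul : (n : ℝ) * (2 * ∑ l ∈ Finset.range n, a l) ≤
        n * (2 * ∑ l ∈ Finset.range (n + 1), a l) := by gcongr
    rw [hsplit]
    push_cast
    linarith

/-- Second-moment bound for the empirical MMD combined with Markov's inequality. The covariances
need only be controlled through the lag. -/
theorem sq_mul_measureReal_mmd_empirical_le (hk : HasKernel H k)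
    (hm : Measurable (Function.uncurry k)) (hb : ∀ y, |k y y| ≤ 1) (μ : Measure Ω)
    [IsProbabilityMeasure μ] {Z : ℕ → Ω → X} (hZ : ∀ i, Measurable (Z i)) {P : Measure X}
    [IsProbabilityMeasure P] {a : ℕ → ℝ}
    (ha : ∀ i j, j ≤ i → |∫ ω, inner ℝ (featureMap H (Z i ω) - kernelMean H P)
      (featureMap H (Z j ω) - kernelMean H P) ∂μ| ≤ a (i - j))
    {n : ℕ} (hn : 1 ≤ n) {ε : ℝ} (hε : 0 < ε) :
    ε ^ 2 * μ.real {ω | ε ≤ mmd k (empirical n fun i => Z i ω) P} ≤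
      2 * ((n : ℝ)⁻¹ * ∑ l ∈ Finset.range n, a l) := by
  have hn0 : (n : ℝ) ≠ 0 := by exact_mod_cast (by omega : n ≠ 0)
  set g := kernelMean H P with hg
  have ha0 : ∀ l, 0 ≤ a l := fun l => (abs_nonneg _).trans (by simpa using ha l 0 (Nat.zero_le l))
  have hsq : ∀ ω, mmd k (empirical n fun i => Z i ω) P ^ 2 =
      (n : ℝ)⁻¹ * ((n : ℝ)⁻¹ * ∑ i ∈ Finset.range n, ∑ j ∈ Finset.range n,
        inner ℝ (featureMap H (Z i ω) - g) (featureMap H (Z j ω) - g)) := fun ω => by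
    have := isProbabilityMeasure_empirical hn fun i => Z i ω
    have hsum : (n : ℝ)⁻¹ • ∑ i ∈ Finset.range n, featureMap H (Z i ω) - g =
        (n : ℝ)⁻¹ • ∑ i ∈ Finset.range n, (featureMap H (Z i ω) - g) := by
      rw [Finset.sum_sub_distrib, smul_sub, Finset.sum_const, Finset.card_range,
        ← Nat.cast_smul_eq_nsmul ℝ, inv_smul_smul₀ hn0]
    rw [mmd_eq_norm_sub hk hm hb, kernelMean_empirical hk hm hb hn, ← hg, hsum,
      ← real_inner_self_eq_norm_sq, real_inner_smul_left, real_inner_smul_right, sum_inner]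
    simp_rw [inner_sum]
  have hI : ∀ i j, Integrable (fun ω => inner ℝ (featureMap H (Z i ω) - g)
      (featureMap H (Z j ω) - g)) μ := fun i j =>
    integrable_inner_featureMap_sub hk hm hb g (hZ i) (hZ j)
  have hint : Integrable (fun ω => mmd k (empirical n fun i => Z i ω) P ^ 2) μ := by
    simp_rw [hsq]
    exact ((integrable_finsetSum _ fun i _ => integrable_finsetSum _ fun j _ =>
      hI i j).const_mul _).const_mul _
  have hset : {ω | ε ≤ mmd k (empirical n fun i => Z i ω) P} =
      {ω | ε ^ 2 ≤ mmd k (empirical n fun i => Z i ω) P ^ 2} := by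
    ext ω
    exact (pow_le_pow_iff_left₀ hε.le (Real.sqrt_nonneg _) two_ne_zero).symm
  rw [hset]
  refine (mul_meas_ge_le_integral_of_nonneg (Eventually.of_forall fun ω => sq_nonneg _)
    hint _).trans ?_
  simp_rw [hsq]
  rw [integral_const_mul, integral_const_mul,
    integral_finsetSum _ fun i _ => integrable_finsetSum _ fun j _ => hI i j]
  simp_rw [integral_finsetSum _ fun j _ => hI _ j]
  have h := sum_sum_le_of_le_lag
    (c := fun i j => ∫ ω, inner ℝ (featureMap H (Z i ω) - g) (featureMap H (Z j ω) - g) ∂μ)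
    (fun i j => integral_inner_featureMap_sub_comm μ g _ _) ha0
    (fun i j hij => (le_abs_self _).trans (ha i j hij)) n
  calc _ ≤ (n : ℝ)⁻¹ * ((n : ℝ)⁻¹ * (n * (2 * ∑ l ∈ Finset.range n, a l))) := by gcongr
    _ = _ := by rw [inv_mul_cancel_left₀ hn0]; ring

/-- Consistency of the empirical measure in MMD when covariances are Cesàro-negligible in the
lag. -/
theorem tendsto_measureReal_mmd_empirical (hk : HasKernel H k)
    (hm : Measurable (Function.uncurry k)) (hb : ∀ y, |k y y| ≤ 1) (μ : Measure Ω)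
    [IsProbabilityMeasure μ] {Z : ℕ → Ω → X} (hZ : ∀ i, Measurable (Z i)) {P : Measure X}
    [IsProbabilityMeasure P] {a : ℕ → ℝ}
    (ha : ∀ i j, j ≤ i → |∫ ω, inner ℝ (featureMap H (Z i ω) - kernelMean H P)
      (featureMap H (Z j ω) - kernelMean H P) ∂μ| ≤ a (i - j))
    (hlim : Tendsto (fun n : ℕ => (n : ℝ)⁻¹ * ∑ l ∈ Finset.range n, a l) atTop (𝓝 0))
    {ε : ℝ} (hε : 0 < ε) :
    Tendsto (fun n : ℕ => μ.real {ω | ε ≤ mmd k (empirical n fun i => Z i ω) P}) atTop (𝓝 0) := by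
  have hlim' := (hlim.const_mul 2).const_mul (ε ^ 2)⁻¹
  rw [mul_zero, mul_zero] at hlim'
  refine tendsto_of_tendsto_of_tendsto_of_le_of_le' tendsto_const_nhds hlim'
    (Eventually.of_forall fun n => measureReal_nonneg) ?_
  filter_upwards [eventually_ge_atTop 1] with n hn
  rw [le_inv_mul_iff₀ (by positivity)]
  exact sq_mul_measureReal_mmd_empirical_le hk hm hb μ hZ ha hn hε

end Dependence

end SimMMD
namespace SimMMD

/-! ### Uniform convergence over the parameter set -/

/-- A set with finite covering numbers at arbitrarily small radii is totally bounded. -/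
theorem totallyBounded_of_coveringNumber {E : Type*} [PseudoMetricSpace E] {Θ : Set E}
    {f : ℝ≥0 → ℝ≥0}
    (h : ∀ᶠ α : ℝ≥0 in 𝓝[>] 0, (Metric.coveringNumber α Θ : ℝ≥0∞) ≤ (f α : ℝ≥0∞)) :
    TotallyBounded Θ := by
  refine Metric.totallyBounded_iff.2 fun ε hε => ?_
  have hlt : ∀ᶠ α : ℝ≥0 in 𝓝[>] 0, α < ε.toNNReal :=
    nhdsWithin_le_nhds (eventually_lt_nhds (Real.toNNReal_pos.2 hε))
  obtain ⟨α, hα, hαε⟩ := (h.and hlt).exists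
  have hne : Metric.coveringNumber α Θ ≠ ⊤ := fun htop => by
    rw [htop] at hα
    simp at hα
  obtain ⟨C, -, hfin, hcov, -⟩ := Metric.exists_set_encard_eq_coveringNumber hne
  refine ⟨C, hfin, fun x hx => ?_⟩
  obtain ⟨y, hy, hxy⟩ := hcov hx
  refine Set.mem_iUnion₂.2 ⟨y, hy, ?_⟩
  have hxy' : edist x y ≤ α := hxy
  rw [Metric.mem_ball, dist_nndist]
  rw [edist_nndist, ENNReal.coe_le_coe] at hxy'
  exact Real.lt_toNNReal_iff_coe_lt.1 (hxy'.trans_lt hαε)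

/-- Pointwise convergence in probability becomes uniform over a totally bounded index set if the
random functions are Hölder with stochastically bounded constants. Only outer measures of the
uncountable unions are involved. -/
theorem tendsto_measureReal_exists_of_holder {Ω E : Type*} [MeasurableSpace Ω]
    [PseudoMetricSpace E] (μ : Measure Ω) [IsFiniteMeasure μ] {Θ : Set E}
    (hΘ : TotallyBounded Θ) {D : ℕ → E → Ω → ℝ} {L : ℕ → Ω → ℝ} {γ : ℝ} (hγ : 0 < γ)
    (hpt : ∀ θ ∈ Θ, ∀ ε : ℝ, 0 < ε → Tendsto (fun n => μ.real {ω | ε ≤ D n θ ω}) atTop (𝓝 0))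
    (hL0 : ∀ n ω, 0 ≤ L n ω)
    (hD : ∀ᶠ n in atTop, ∀ ω, ∀ θ ∈ Θ, ∀ θ' ∈ Θ, D n θ ω ≤ D n θ' ω + L n ω * dist θ θ' ^ γ)
    {B : ℝ} (hL : ∀ᶠ n in atTop, ∀ c : ℝ, c * μ.real {ω | c ≤ L n ω} ≤ B) {ε : ℝ} (hε : 0 < ε) :
    Tendsto (fun n => μ.real {ω | ∃ θ ∈ Θ, ε ≤ D n θ ω}) atTop (𝓝 0) := by
  have hB : 0 ≤ B := by
    obtain ⟨n, hn⟩ := hL.exists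
    simpa using hn 0
  rw [tendsto_order]
  refine ⟨fun b hb => Eventually.of_forall fun n => hb.trans_le measureReal_nonneg,
    fun η hη => ?_⟩
  -- A net of mesh `b ^ (1 / γ)` changes `D` by at most `L * b`; the choice of `b` makes Markov's
  -- inequality bound the probability of `ε / 2 ≤ L * b` by `η / 2`.
  obtain ⟨b, hb, hbη⟩ : ∃ b : ℝ, 0 < b ∧ B * (b * (2 / ε)) < η / 2 := by
    refine ⟨η * ε / (4 * (B + 1)), by positivity, ?_⟩
    rw [show B * (η * ε / (4 * (B + 1)) * (2 / ε)) = η / 2 * (B / (B + 1)) by field_simp; ring]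
    exact mul_lt_of_lt_one_right (by positivity) ((div_lt_one (by positivity)).2 (by linarith))
  have hα : 0 < b ^ γ⁻¹ := Real.rpow_pos_of_pos hb _
  obtain ⟨C, hCΘ, hCfin, hcov⟩ := Metric.finite_approx_of_totallyBounded hΘ _ hα
  have hnet : Tendsto (fun n => ∑ θ ∈ hCfin.toFinset, μ.real {ω | ε / 2 ≤ D n θ ω}) atTop
      (𝓝 0) := by
    simpa using tendsto_finsetSum hCfin.toFinset fun θ hθ =>
      hpt θ (hCΘ (hCfin.mem_toFinset.1 hθ)) (ε / 2) (half_pos hε)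
  filter_upwards [hD, hL, hnet.eventually_lt_const (half_pos hη)] with n hDn hLn hnetn
  have hsub : {ω | ∃ θ ∈ Θ, ε ≤ D n θ ω} ⊆
      (⋃ θ ∈ hCfin.toFinset, {ω | ε / 2 ≤ D n θ ω}) ∪ {ω | (b * (2 / ε))⁻¹ ≤ L n ω} := by
    rintro ω ⟨θ, hθ, hεD⟩
    obtain ⟨θ', hθ', hd⟩ := Set.mem_iUnion₂.1 (hcov hθ)
    by_cases h : ε / 2 ≤ D n θ' ω
    · exact Or.inl (Set.mem_iUnion₂.2 ⟨θ', hCfin.mem_toFinset.2 hθ', h⟩)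
    · right
      have hdist : dist θ θ' ^ γ ≤ b := by
        have := Real.rpow_le_rpow dist_nonneg (le_of_lt hd) hγ.le
        rwa [Real.rpow_inv_rpow hb.le hγ.ne'] at this
      have h1 := hDn ω θ hθ θ' (hCΘ hθ')
      have h2 := mul_le_mul_of_nonneg_left hdist (hL0 n ω)
      have h3 : ε / 2 ≤ L n ω * b := by linarith [not_le.1 h]
      change (b * (2 / ε))⁻¹ ≤ L n ω
      rw [inv_le_iff_one_le_mul₀ (by positivity)]
      calc (1 : ℝ) = ε / 2 * (2 / ε) := by field_simp
        _ ≤ L n ω * b * (2 / ε) := by gcongr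
        _ = _ := by ring
  have hmarkov : μ.real {ω | (b * (2 / ε))⁻¹ ≤ L n ω} ≤ B * (b * (2 / ε)) := by
    have := hLn (b * (2 / ε))⁻¹
    rw [inv_mul_le_iff₀ (by positivity)] at this
    linarith
  calc μ.real {ω | ∃ θ ∈ Θ, ε ≤ D n θ ω}
      ≤ μ.real ((⋃ θ ∈ hCfin.toFinset, {ω | ε / 2 ≤ D n θ ω}) ∪
          {ω | (b * (2 / ε))⁻¹ ≤ L n ω}) := measureReal_mono hsub
    _ ≤ ∑ θ ∈ hCfin.toFinset, μ.real {ω | ε / 2 ≤ D n θ ω} +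
          μ.real {ω | (b * (2 / ε))⁻¹ ≤ L n ω} :=
        (measureReal_union_le _ _).trans
          (add_le_add_left (measureReal_biUnion_finset_le _ _) _)
    _ < η := by linarith

section UniformLaw

variable {X : Type*} [MeasurableSpace X] {H : Type*} [NormedAddCommGroup H]
  [InnerProductSpace ℝ H] [CompleteSpace H] [RKHS ℝ H X ℝ] {k : X → X → ℝ}

theorem norm_kernelMean_empirical_sub_le (hk : HasKernel H k)
    (hm : Measurable (Function.uncurry k)) (hb : ∀ y, |k y y| ≤ 1) {n : ℕ} (hn : 1 ≤ n)
    {z w : ℕ → X} {b : ℕ → ℝ} (h : ∀ i, ‖featureMap H (z i) - featureMap H (w i)‖ ≤ b i) :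
    ‖kernelMean H (empirical n z) - kernelMean H (empirical n w)‖ ≤
      (n : ℝ)⁻¹ * ∑ i ∈ Finset.range n, b i := by
  rw [kernelMean_empirical hk hm hb hn, kernelMean_empirical hk hm hb hn, ← smul_sub,
    ← Finset.sum_sub_distrib, norm_smul, norm_inv, Real.norm_natCast]
  gcongr
  exact norm_sum_le_of_le _ fun i _ => h i

/-- Uniform law of large numbers in MMD for a simulated model whose features are Hölder in the
parameter and whose covariances are Cesàro-negligible in the lag, at each parameter value. -/
theorem tendsto_measureReal_exists_mmd_empirical (hk : HasKernel H k)
    (hm : Measurable (Function.uncurry k)) (hb : ∀ y, |k y y| ≤ 1) {E 𝕌 Ω : Type*}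
    [PseudoMetricSpace E] [MeasurableSpace 𝕌] [MeasurableSpace Ω] {P𝕌 : Measure 𝕌}
    [IsProbabilityMeasure P𝕌] {μ : Measure Ω} [IsProbabilityMeasure μ] {Θ : Set E}
    (hΘ : TotallyBounded Θ) {ψ : E → 𝕌 → X} (hψ : ∀ θ ∈ Θ, Measurable (ψ θ))
    {γ : ℝ} (hγ : 0 < γ) {m : 𝕌 → ℝ} (hm_int : Integrable m P𝕌)
    (hholder : ∀ u : 𝕌, ∀ θ ∈ Θ, ∀ θ' ∈ Θ,
      ‖featureMap H (ψ θ u) - featureMap H (ψ θ' u)‖ ≤ m u * dist θ θ' ^ γ)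
    {U : ℕ → Ω → 𝕌} (hU : ∀ i, MeasurePreserving (U i) μ P𝕌) {a : ℕ → ℝ}
    (ha : ∀ θ ∈ Θ, ∀ i j, j ≤ i →
      |∫ ω, inner ℝ (featureMap H (ψ θ (U i ω)) - kernelMean H (P𝕌.map (ψ θ)))
        (featureMap H (ψ θ (U j ω)) - kernelMean H (P𝕌.map (ψ θ))) ∂μ| ≤ a (i - j))
    (hlim : Tendsto (fun n : ℕ => (n : ℝ)⁻¹ * ∑ l ∈ Finset.range n, a l) atTop (𝓝 0))
    {ε : ℝ} (hε : 0 < ε) :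
    Tendsto (fun n : ℕ => μ.real {ω | ∃ θ ∈ Θ,
      ε ≤ mmd k (empirical n fun i => ψ θ (U i ω)) (P𝕌.map (ψ θ))}) atTop (𝓝 0) := by
  have hprob : ∀ θ ∈ Θ, IsProbabilityMeasure (P𝕌.map (ψ θ)) := fun θ hθ =>
    Measure.isProbabilityMeasure_map (hψ θ hθ).aemeasurable
  have habs : ∀ u : 𝕌, ∀ θ ∈ Θ, ∀ θ' ∈ Θ,
      ‖featureMap H (ψ θ u) - featureMap H (ψ θ' u)‖ ≤ |m u| * dist θ θ' ^ γ :=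
    fun u θ hθ θ' hθ' => (hholder u θ hθ θ' hθ').trans
      (mul_le_mul_of_nonneg_right (le_abs_self _) (Real.rpow_nonneg dist_nonneg _))
  have hmU : ∀ i, Integrable (fun ω => |m (U i ω)|) μ := fun i =>
    ((hU i).integrable_comp_of_integrable hm_int).abs
  have hmU' : ∀ i, ∫ ω, |m (U i ω)| ∂μ = ∫ u, |m u| ∂P𝕌 := fun i => by
    rw [← (hU i).map_eq, integral_map (hU i).measurable.aemeasurable]
    rw [(hU i).map_eq]
    exact hm_int.abs.aestronglyMeasurable
  set B := ∫ u, |m u| ∂P𝕌 with hBdef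
  have hB0 : 0 ≤ B := integral_nonneg fun u => abs_nonneg _
  refine tendsto_measureReal_exists_of_holder μ hΘ
    (D := fun n θ ω => mmd k (empirical n fun i => ψ θ (U i ω)) (P𝕌.map (ψ θ)))
    (L := fun n ω => (n : ℝ)⁻¹ * ∑ i ∈ Finset.range n, |m (U i ω)| + B) (B := B + B) hγ
    (fun θ hθ ε hε => ?_) (fun n ω => by positivity) ?_ ?_ hε
  · have := hprob θ hθ
    exact tendsto_measureReal_mmd_empirical hk hm hb μ
      (fun i => (hψ θ hθ).comp (hU i).measurable) (ha θ hθ) hlim hε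
  · filter_upwards [eventually_ge_atTop 1] with n hn ω θ hθ θ' hθ'
    have := hprob θ hθ
    have := hprob θ' hθ'
    have := isProbabilityMeasure_empirical hn fun i => ψ θ (U i ω)
    have := isProbabilityMeasure_empirical hn fun i => ψ θ' (U i ω)
    have h1 := norm_kernelMean_empirical_sub_le hk hm hb hn
      (z := fun i => ψ θ (U i ω)) (w := fun i => ψ θ' (U i ω))
      fun i => habs (U i ω) θ hθ θ' hθ'
    have h2 := norm_kernelMean_map_sub_le hk hm hb P𝕌 (hψ θ' hθ') (hψ θ hθ)
      (hm_int.abs.mul_const (dist θ θ' ^ γ))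
      fun u => by rw [norm_sub_rev]; exact habs u θ hθ θ' hθ'
    rw [integral_mul_const, ← hBdef] at h2
    rw [← Finset.sum_mul, ← mul_assoc] at h1
    simp_rw [mmd_eq_norm_sub hk hm hb, ← dist_eq_norm] at h1 h2 ⊢
    rw [add_mul]
    linarith [dist_triangle4 (kernelMean H (empirical n fun i => ψ θ (U i ω)))
      (kernelMean H (empirical n fun i => ψ θ' (U i ω))) (kernelMean H (P𝕌.map (ψ θ')))
      (kernelMean H (P𝕌.map (ψ θ)))]
  · filter_upwards [eventually_ge_atTop 1] with n hn c
    have hn0 : (n : ℝ) ≠ 0 := by exact_mod_cast (by omega : n ≠ 0)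
    have hsum : Integrable (fun ω => (n : ℝ)⁻¹ * ∑ i ∈ Finset.range n, |m (U i ω)|) μ :=
      (integrable_finsetSum _ fun i _ => hmU i).const_mul _
    have hsum' : Integrable (fun ω => (n : ℝ)⁻¹ * ∑ i ∈ Finset.range n, |m (U i ω)| + B) μ :=
      hsum.add (integrable_const B)
    have hnonneg : ∀ ω, 0 ≤ (n : ℝ)⁻¹ * ∑ i ∈ Finset.range n, |m (U i ω)| + B := fun ω => by
      positivity
    refine (mul_meas_ge_le_integral_of_nonneg (Eventually.of_forall hnonneg) hsum' c).trans ?_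
    rw [integral_add hsum (integrable_const B), integral_const_mul,
      integral_finsetSum _ fun i _ => hmU i]
    simp [hmU', hn0]

end UniformLaw

/-! ### Consistency of the estimator -/

theorem betaMixing_le_iSup {Ω X ι : Type*} [MeasurableSpace Ω] [MeasurableSpace X]
    (μ : Measure Ω) [IsProbabilityMeasure μ] (Z : ι → ℕ → Ω → X) (n : ℕ) (θ : ι) :
    betaMixing μ (Z θ) n ≤ ⨆ θ, betaMixing μ (Z θ) n :=
  le_ciSup (f := fun θ => betaMixing μ (Z θ) n)
    ⟨1, by rintro _ ⟨θ, rfl⟩; exact betaMixing_le_one μ (Z θ) n⟩ θ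

theorem tendsto_cesaro_of_sum_Icc_isLittleO {a : ℕ → ℝ} (ha : ∀ l, 0 ≤ a l)
    (h : (fun T : ℕ => ∑ t ∈ Finset.Icc 1 T, a t) =o[atTop] fun T : ℕ => (T : ℝ)) :
    Tendsto (fun n : ℕ => (n : ℝ)⁻¹ * ∑ l ∈ Finset.range n, a l) atTop (𝓝 0) := by
  have h1 := h.tendsto_div_nhds_zero
  have h2 : Tendsto (fun n : ℕ => a 0 / (n : ℝ)) atTop (𝓝 0) :=
    tendsto_const_div_atTop_nhds_zero_nat _
  have h3 := h1.add h2
  rw [add_zero] at h3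
  refine squeeze_zero (fun n => mul_nonneg (by positivity) (Finset.sum_nonneg fun l _ => ha l))
    (fun n => ?_) h3
  rw [← add_div, inv_mul_eq_div]
  gcongr
  calc ∑ l ∈ Finset.range n, a l ≤ ∑ l ∈ Finset.range (n + 1), a l := by
        rw [Finset.sum_range_succ]; linarith [ha n]
    _ = ∑ t ∈ Finset.Icc 1 n, a t + a 0 := by
        rw [Finset.range_eq_Ico, Finset.sum_eq_sum_Ico_succ_bot (Nat.succ_pos n), add_comm]
        rfl

end SimMMD

theorem mainTheorem3
    {d q : ℕ}
    -- parameter set, observation space, innovation paths, common probability space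
    (Θ : Set (EuclideanSpace ℝ (Fin d))) (𝒴 : Set (EuclideanSpace ℝ (Fin q)))
    {𝕌 : Type*} [MeasurableSpace 𝕌] (P𝕌 : Measure 𝕌) [IsProbabilityMeasure P𝕌]
    {Ω : Type*} [MeasurableSpace Ω] (μ : Measure Ω) [IsProbabilityMeasure μ]
    -- measurable kernel `k` with RKHS `H`, `sup_y |k(y, y)| ≤ 1`
    {H : Type*} [NormedAddCommGroup H] [InnerProductSpace ℝ H] [CompleteSpace H] [RKHS ℝ H 𝒴 ℝ]
    (k : 𝒴 → 𝒴 → ℝ) (hkH : SimMMD.HasKernel H k) (hk_meas : Measurable (Function.uncurry k))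
    (hk_bdd : ∀ y, |k y y| ≤ 1)
    -- the observed stationary process (`y 0` is the first observation)
    (y : ℕ → Ω → 𝒴) (hy_meas : ∀ t, Measurable (y t)) (hy_stat : SimMMD.StrictlyStationary μ y)
    -- `Σ_T = o(T)`
    (h_sum : (fun T : ℕ => ∑ t ∈ Finset.Icc 1 T, SimMMD.rho H μ y t) =o[atTop] fun T : ℕ => (T : ℝ))
    -- the model: `P_θ` is the image of `P𝕌` under `ψ θ`
    (ψ : EuclideanSpace ℝ (Fin d) → 𝕌 → 𝒴) (hψ : ∀ θ ∈ Θ, Measurable (ψ θ))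
    -- (i) unique minimizer and (ii) well-separation
    (θs : EuclideanSpace ℝ (Fin d))
    (h_i : {θ ∈ Θ | IsMinOn (fun θ => SimMMD.mmd k (P𝕌.map (ψ θ)) (μ.map (y 0))) Θ θ} = {θs})
    (h_ii : ∀ r : ℝ, 0 < r →
      (SimMMD.mmd k (P𝕌.map (ψ θs)) (μ.map (y 0)) : EReal) <
        ⨅ θ ∈ {θ ∈ Θ | r ≤ ‖θ - θs‖}, (SimMMD.mmd k (P𝕌.map (ψ θ)) (μ.map (y 0)) : EReal))
    -- (iii) polynomial covering numbers
    (π : ℝ) (hπ : 0 < π)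
    (h_iii : ∃ C : ℝ≥0, ∀ᶠ α : ℝ≥0 in 𝓝[>] 0,
      (Metric.coveringNumber α Θ : ℝ≥0∞) ≤ ((C * α ^ (-π) : ℝ≥0) : ℝ≥0∞))
    -- (iv) Hölder condition in the RKHS
    (γ : ℝ) (hγ : 0 < γ) (m : 𝕌 → ℝ) (hm_meas : Measurable m) (hm_int : Integrable m P𝕌)
    (h_iv : ∀ u : 𝕌, ∀ θ ∈ Θ, ∀ θ' ∈ Θ,
      ‖SimMMD.featureMap H (ψ θ u) - SimMMD.featureMap H (ψ θ' u)‖ ≤ m u * ‖θ - θ'‖ ^ γ)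
    -- the simulated innovation paths, with arbitrary mutual dependence
    (U : ℕ → Ω → 𝕌) (hU : ∀ i, MeasurePreserving (U i) μ P𝕌)
    -- (v) uniformly fast β-mixing of the simulated sequences
    (h_v : (fun n : ℕ => ⨆ θ : Θ, SimMMD.betaMixing μ (fun i ω => ψ θ (U i ω)) n)
      =o[atTop] fun n : ℕ => (n : ℝ) ^ (-(2 * π + 1)))
    -- the estimator: a minimizer of the simulated MMD criterion
    (θt : ℕ → ℕ → Ω → EuclideanSpace ℝ (Fin d))
    (hθt : ∀ N T : ℕ, 1 ≤ N → 1 ≤ T → ∀ᵐ ω ∂μ,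
      θt N T ω ∈ Θ ∧
      IsMinOn (fun θ => SimMMD.mmd k (SimMMD.empirical N fun i => ψ θ (U i ω))
        (SimMMD.empirical T fun t => y t ω)) Θ (θt N T ω)) :
    TendstoInMeasure μ (fun NT : ℕ × ℕ => θt NT.1 NT.2) (atTop ×ˢ atTop) (fun _ => θs) := by

  have hΘ : TotallyBounded Θ := by
    obtain ⟨C, hC⟩ := h_iii
    exact SimMMD.totallyBounded_of_coveringNumber hC
  have hθs : θs ∈ Θ := by
    have : θs ∈ ({θs} : Set (EuclideanSpace ℝ (Fin d))) := rfl
    rw [← h_i] at this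
    exact this.1
  set P : EuclideanSpace ℝ (Fin d) → Measure 𝒴 := fun θ => P𝕌.map (ψ θ) with hP
  have hprob : ∀ θ ∈ Θ, IsProbabilityMeasure (P θ) := fun θ hθ =>
    Measure.isProbabilityMeasure_map (hψ θ hθ).aemeasurable
  have hprob₀ : IsProbabilityMeasure (μ.map (y 0)) :=
    Measure.isProbabilityMeasure_map (hy_meas 0).aemeasurable
  have hobs : ∀ ε : ℝ, 0 < ε → Tendsto (fun T : ℕ =>
      μ.real {ω | ε ≤ SimMMD.mmd k (SimMMD.empirical T fun t => y t ω) (μ.map (y 0))}) atTop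
      (𝓝 0) := fun ε hε =>
    SimMMD.tendsto_measureReal_mmd_empirical hkH hk_meas hk_bdd μ hy_meas
      (fun _ _ hts => (hy_stat.abs_integral_inner_eq_rho hkH hk_meas hts).le)
      (SimMMD.tendsto_cesaro_of_sum_Icc_isLittleO (fun _ => abs_nonneg _) h_sum) hε
  have hsim : ∀ ε : ℝ, 0 < ε → Tendsto (fun N : ℕ => μ.real {ω | ∃ θ ∈ Θ,
      ε ≤ SimMMD.mmd k (SimMMD.empirical N fun i => ψ θ (U i ω)) (P θ)}) atTop (𝓝 0) := by
    intro ε hε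
    refine SimMMD.tendsto_measureReal_exists_mmd_empirical hkH hk_meas hk_bdd hΘ hψ hγ hm_int
      (fun u θ hθ θ' hθ' => by rw [dist_eq_norm]; exact h_iv u θ hθ θ' hθ') hU
      (a := fun n => 2 * ⨆ θ : Θ, SimMMD.betaMixing μ (fun i ω => ψ θ (U i ω)) n)
      (fun θ hθ i j hji => ?_) ?_ hε
    · have := hprob θ hθ
      have hlaw : ∀ i, μ.map (fun ω => ψ θ (U i ω)) = P θ := fun i => by
        change _ = P𝕌.map (ψ θ)
        rw [← (hU i).map_eq, Measure.map_map (hψ θ hθ) (hU i).measurable]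
        rfl
      refine (SimMMD.abs_integral_inner_featureMap_sub_le_betaMixing hkH hk_meas hk_bdd μ
        (Z := fun i ω => ψ θ (U i ω)) (fun i => (hψ θ hθ).comp (hU i).measurable) hlaw
        hji).trans ?_
      gcongr
      exact SimMMD.betaMixing_le_iSup μ (fun (θ : Θ) i ω => ψ θ (U i ω)) _ ⟨θ, hθ⟩
    · have hβ : Tendsto (fun n : ℕ => ⨆ θ : Θ, SimMMD.betaMixing μ (fun i ω => ψ θ (U i ω)) n)
          atTop (𝓝 0) :=
        h_v.trans_tendsto ((tendsto_rpow_neg_atTop (by positivity)).comp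
          tendsto_natCast_atTop_atTop)
      simpa using (hβ.const_mul 2).cesaro
  rw [tendstoInMeasure_iff_measureReal_norm]
  intro r hr
  obtain ⟨x, hx, hxr⟩ := EReal.lt_iff_exists_real_btwn.1 (h_ii r hr)
  rw [EReal.coe_lt_coe_iff] at hx
  -- the gap `δ` of the population criterion outside the ball of radius `r`
  obtain ⟨δ, hδ, hgap⟩ : ∃ δ : ℝ, 0 < δ ∧ ∀ θ ∈ Θ, r ≤ ‖θ - θs‖ →
      SimMMD.mmd k (P θs) (μ.map (y 0)) + δ ≤ SimMMD.mmd k (P θ) (μ.map (y 0)) := by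
    refine ⟨x - SimMMD.mmd k (P θs) (μ.map (y 0)), sub_pos.2 hx, fun θ hθ hθr => ?_⟩
    have := hxr.trans_le (iInf₂_le θ ⟨hθ, hθr⟩)
    rw [EReal.coe_lt_coe_iff] at this
    linarith
  have hlim := ((hsim (δ / 4) (by positivity)).comp
    (tendsto_fst (f := (atTop : Filter ℕ)) (g := (atTop : Filter ℕ)))).add
    ((hobs (δ / 4) (by positivity)).comp
      (tendsto_snd (f := (atTop : Filter ℕ)) (g := (atTop : Filter ℕ))))
  rw [add_zero] at hlim
  refine tendsto_of_tendsto_of_tendsto_of_le_of_le' tendsto_const_nhds hlim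
    (Eventually.of_forall fun _ => measureReal_nonneg) ?_
  filter_upwards [(eventually_ge_atTop 1).prod_mk (eventually_ge_atTop 1)]
  rintro ⟨N, T⟩ ⟨hN, hT⟩
  refine le_trans (ENNReal.toReal_mono (measure_ne_top _ _) (measure_mono_ae ?_))
    (measureReal_union_le _ _)
  filter_upwards [hθt N T hN hT] with ω ⟨hmem, hmin⟩ (hfar : r ≤ ‖θt N T ω - θs‖)
  by_contra hnot
  obtain ⟨hS, hR⟩ := not_or.1 hnot
  have hS : ∀ θ ∈ Θ,
      SimMMD.mmd k (SimMMD.empirical N fun i => ψ θ (U i ω)) (P θ) < δ / 4 := fun θ hθ =>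
    not_le.1 fun h => hS ⟨θ, hθ, h⟩
  have hR : SimMMD.mmd k (SimMMD.empirical T fun t => y t ω) (μ.map (y 0)) < δ / 4 :=
    not_le.1 hR
  have hg := hgap _ hmem hfar
  have h1 := hS _ hmem
  have h2 := hS _ hθs
  have h3 := isMinOn_iff.1 hmin θs hθs
  have := hprob _ hmem
  have := hprob _ hθs
  have := SimMMD.isProbabilityMeasure_empirical hT fun t => y t ω
  have := SimMMD.isProbabilityMeasure_empirical hN fun i => ψ (θt N T ω) (U i ω)
  have := SimMMD.isProbabilityMeasure_empirical hN fun i => ψ θs (U i ω)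
  simp_rw [SimMMD.mmd_eq_norm_sub hkH hk_meas hk_bdd, ← dist_eq_norm] at hg h1 h2 h3 hR
  have t1 := dist_triangle4 (SimMMD.kernelMean H (P (θt N T ω)))
    (SimMMD.kernelMean H (SimMMD.empirical N fun i => ψ (θt N T ω) (U i ω)))
    (SimMMD.kernelMean H (SimMMD.empirical T fun t => y t ω)) (SimMMD.kernelMean H (μ.map (y 0)))
  have t2 := dist_triangle4
    (SimMMD.kernelMean H (SimMMD.empirical N fun i => ψ θs (U i ω)))
    (SimMMD.kernelMean H (P θs)) (SimMMD.kernelMean H (μ.map (y 0)))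
    (SimMMD.kernelMean H (SimMMD.empirical T fun t => y t ω))
  rw [dist_comm (SimMMD.kernelMean H (P (θt N T ω)))
    (SimMMD.kernelMean H (SimMMD.empirical N fun i => ψ (θt N T ω) (U i ω)))] at t1
  rw [dist_comm (SimMMD.kernelMean H (μ.map (y 0)))] at t2
  linarith
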